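/- A binary $(N,K,d)$-code is a set $C\subseteq\{0,1\}^N$ with $|C|=K$ in which any two different words are at Hamming distance at least $d$; a Hadamard code of length $N$ is a binary $(N,2N,N/2)$-code. The Gray map $\phi:\mathbb Z_4^n\to\{0,1\}^{2n}$ is $\phi(c)=(\beta(c),\gamma(c))$, where $\beta$ and $\gamma$ act coordinatewise and send $0,1,2,3$ to $0,0,1,1$ and to $0,1,1,0$, respectively. A binary code $C$ of length $2n$ is $\mathbb Z_4$-linear if $C=\pi(\phi(\mathcal C))$ for some additive subgroup $\mathcal C$ of $\mathbb Z_4^n$ and some permutation $\pi$ of the $2n$ coordinates. Binary codes $C,C'$ of length $N$ are equivalent if $C=\pi(C'\oplus y)$ for some $y\in\{0,1\}^N$ and some permutation $\pi$ of the $N$ coordinates. **Theorem.** If $N=2^k\ge 8$, then there are exactly $\lfloor (k-1)/2\rfloor$ pairwise nonequivalent $\mathbb Z_4$-linear Hadamard codes of length $N$; that is, the $\mathbb Z_4$-linear $(N,2N,N/2)$-codes form exactly $\lfloor (k-1)/2\rfloor$ equivalence classes. -/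

import Mathlib

/-- A binary code of length `N`: a set of binary words of length `N`. -/
abbrev BinaryCode (N : ℕ) : Type := Set (Fin N → ZMod 2)

/-- `C` is a binary `(N, K, d)`-code: it has exactly `K` words, and any two different words are
at Hamming distance at least `d`. -/
def IsBinaryCode {N : ℕ} (C : BinaryCode N) (K d : ℕ) : Prop :=
  C.ncard = K ∧ ∀ x ∈ C, ∀ y ∈ C, x ≠ y → d ≤ hammingDist x y

/-- A Hadamard code of length `N`: a binary `(N, 2N, N/2)`-code (used for even `N`). -/
def IsHadamardCode {N : ℕ} (C : BinaryCode N) : Prop :=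
  IsBinaryCode C (2 * N) (N / 2)

/-- The map `β` from `ZMod 4` to `ZMod 2`: it sends `0, 1, 2, 3` to `0, 0, 1, 1`. -/
def grayBeta (c : ZMod 4) : ZMod 2 :=
  if c = 2 ∨ c = 3 then 1 else 0

/-- The map `γ` from `ZMod 4` to `ZMod 2`: it sends `0, 1, 2, 3` to `0, 1, 1, 0`. -/
def grayGamma (c : ZMod 4) : ZMod 2 :=
  if c = 1 ∨ c = 2 then 1 else 0

/-- The Gray map: the `i`-th coordinate of `c` gives the coordinates `i` and `n + i` of the
binary word `(β(c), γ(c))`. -/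
def grayMap {n : ℕ} (c : Fin n → ZMod 4) : Fin (n + n) → ZMod 2 :=
  Fin.append (fun i => grayBeta (c i)) (fun i => grayGamma (c i))

/-- `C` is `Z₄`-linear: up to a permutation of the coordinates, it is the image under the Gray map
of an additive subgroup of `Z₄ⁿ`. The bijection `π` between the two index sets, which
exists only if `N = n + n`, is the permutation of coordinates. -/
def IsZ4Linear {N : ℕ} (C : BinaryCode N) : Prop :=
  ∃ (n : ℕ) (Q : AddSubgroup (Fin n → ZMod 4)) (π : Fin N ≃ Fin (n + n)),
    C = (fun c : Fin n → ZMod 4 => grayMap c ∘ π) '' (Q : Set (Fin n → ZMod 4))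

/-- Binary codes `C`, `C'` of length `N` are equivalent: `C = π(C' ⊕ y)` for some binary word `y`
and some permutation `π` of the coordinates. -/
def BinaryCode.Equivalent {N : ℕ} (C C' : BinaryCode N) : Prop :=
  ∃ (y : Fin N → ZMod 2) (π : Equiv.Perm (Fin N)),
    C = (fun x : Fin N → ZMod 2 => (x + y) ∘ π) '' C'

theorem BinaryCode.equivalent_equivalence (N : ℕ) :
    Equivalence (@BinaryCode.Equivalent N) where
  refl C := ⟨0, 1, by ext x; simp⟩
  symm := by
    rintro C C' ⟨y, π, rfl⟩
    refine ⟨-(y ∘ π), π.symm, ?_⟩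
    have h : ∀ z : Fin N → ZMod 2,
        ((z + y) ∘ π + -(y ∘ π)) ∘ π.symm = z := by
      intro z
      funext i
      simp only [Function.comp_apply, Pi.add_apply, Pi.neg_apply, Equiv.apply_symm_apply]
      ring
    rw [Set.image_image]
    simp only [h, Set.image_id']
  trans := by
    rintro C C' C'' ⟨y, π, rfl⟩ ⟨z, σ, rfl⟩
    refine ⟨z + y ∘ σ.symm, σ * π, ?_⟩
    rw [Set.image_image]
    congr 1
    funext x i
    simp [add_assoc]

/-- The `Z₄`-linear Hadamard codes of length `N`. -/
def Z4LinearHadamardCode (N : ℕ) : Type :=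
  {C : BinaryCode N // IsZ4Linear C ∧ IsHadamardCode C}

/-- Equivalence of binary codes, restricted to the `Z₄`-linear Hadamard codes of length `N`. -/
def z4LinearHadamardSetoid (N : ℕ) : Setoid (Z4LinearHadamardCode N) where
  r C C' := BinaryCode.Equivalent C.1 C'.1
  iseqv :=
    ⟨fun C => (BinaryCode.equivalent_equivalence N).refl C.1,
      fun h => (BinaryCode.equivalent_equivalence N).symm h,
      fun h h' => (BinaryCode.equivalent_equivalence N).trans h h'⟩

/-! Let `Q` be the subgroup of Z₄ⁿ behind a code of length N = 2n, so |Q| = 4n. The Lee weight of c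
is n − `cosSum c`, and the distance condition says `cosSum c ≤ 0` for c ≠ 0. Orthogonality of
characters gives ∑ `cosSum c` = 0 and bounds ∑ `cosSum c`² below by 2n², while the distance
condition bounds it above by 2n². Equality throughout shows that no two coordinate characters agree
up to sign, none has order at most 2, and the constant word 2 is twice some w in `Q`. Multiplying by
w coordinatewise only permutes Gray coordinates and turns w into 1. A basis of `Q` adapted to its
2-torsion then sends coordinates injectively, and by counting bijectively, to Z₄^m × Z₂^s, so the
code becomes the code of affine functions there (`IsQuaternaryHadamard.hasAffineType`), with k = 2m
+ s + 1. Conversely every such affine code is Z₄-linear and Hadamard. It remains to compare types.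
Types m = 0 and m = 1 give the same code up to coordinates (`HasAffineType.rank_one`). The
translation kernel has at least 2^(m+s+2) = 2^(k+1−m) words, with equality if m ≥ 2, which separates
m = 1, …, ⌊(k−1)/2⌋. -/

set_option linter.unusedSectionVars false

/-! ### Z₄-valued characters of finite abelian groups -/

/-- The real part of `i ^ c`, that is, `1` minus the Lee weight of `c`. -/
def quarterCos (c : ZMod 4) : ℤ :=
  if c = 0 then 1 else if c = 2 then -1 else 0

theorem quarterCos_zero : quarterCos 0 = 1 := rfl

theorem quarterCos_add_two : ∀ c, quarterCos (c + 2) = -quarterCos c := by decide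

theorem neg_one_le_quarterCos : ∀ c, -1 ≤ quarterCos c := by decide

theorem eq_two_of_quarterCos : ∀ c, quarterCos c = -1 → c = 2 := by decide

theorem two_mul_quarterCos_mul :
    ∀ a b, 2 * (quarterCos a * quarterCos b) = quarterCos (a - b) + quarterCos (a + b) := by
  decide

theorem ZMod.eq_two_or_two_mul_eq_two : ∀ c : ZMod 4, c ≠ 0 → c = 2 ∨ c + c = 2 := by decide

section CharacterSums

variable {G : Type*} [AddCommGroup G] [Fintype G]

/-- A nontrivial character takes the value 2; translating the sum by a preimage of 2 negates every
term. -/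
theorem sum_quarterCos_hom (χ : G →+ ZMod 4) (h : ∃ g, χ g ≠ 0) (a : ZMod 4) :
    ∑ g, quarterCos (a + χ g) = 0 := by
  obtain ⟨g₀, h₀⟩ : ∃ g₀, χ g₀ = 2 := by
    obtain ⟨g, hg⟩ := h
    rcases ZMod.eq_two_or_two_mul_eq_two _ hg with h | h
    · exact ⟨g, h⟩
    · exact ⟨g + g, by rw [map_add, h]⟩
  have key : ∑ g, quarterCos (a + χ g) = -∑ g, quarterCos (a + χ g) := by
    rw [← Finset.sum_neg_distrib, ← Equiv.sum_comp (Equiv.addRight g₀)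
      (fun g => quarterCos (a + χ g))]
    refine Finset.sum_congr rfl fun g _ => ?_
    rw [Equiv.coe_addRight, map_add, h₀, ← add_assoc, quarterCos_add_two]
  omega

theorem sum_quarterCos_of_trivial (χ : G →+ ZMod 4) (h : ∀ g, χ g = 0) :
    ∑ g, quarterCos (χ g) = Fintype.card G := by
  simp [h, quarterCos_zero]

theorem sum_quarterCos_hom' (χ : G →+ ZMod 4) (h : ∃ g, χ g ≠ 0) :
    ∑ g, quarterCos (χ g) = 0 := by
  simpa using sum_quarterCos_hom χ h 0

theorem sum_quarterCos_nonneg (χ : G →+ ZMod 4) : 0 ≤ ∑ g, quarterCos (χ g) := by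
  by_cases h : ∃ g, χ g ≠ 0
  · rw [sum_quarterCos_hom' χ h]
  · push Not at h
    rw [sum_quarterCos_of_trivial χ h]
    positivity

theorem exists_ne_zero_of_sum_quarterCos (χ : G →+ ZMod 4)
    (h : ∑ g, quarterCos (χ g) < Fintype.card G) : ∃ g, χ g ≠ 0 := by
  by_contra! h'
  rw [sum_quarterCos_of_trivial χ h'] at h
  exact lt_irrefl _ h

end CharacterSums

/-! ### First and second moments of the Lee weight -/

section Moments

variable {I : Type*} [Fintype I]

/-- Length minus Lee weight of a quaternary word. -/
def cosSum (c : I → ZMod 4) : ℤ := ∑ i, quarterCos (c i)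

theorem cosSum_zero : cosSum (0 : I → ZMod 4) = Fintype.card I := by
  simp [cosSum, quarterCos_zero]

theorem neg_card_le_cosSum (c : I → ZMod 4) : -(Fintype.card I : ℤ) ≤ cosSum c := by
  have : ∑ _i : I, (-1 : ℤ) ≤ cosSum c := Finset.sum_le_sum fun i _ => neg_one_le_quarterCos _
  simpa using this

theorem eq_two_of_cosSum {c : I → ZMod 4} (h : cosSum c = -(Fintype.card I : ℤ)) (i : I) :
    c i = 2 := by
  have h0 : ∑ i, (quarterCos (c i) + 1) = 0 := by
    rw [Finset.sum_add_distrib]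
    simp only [cosSum] at h
    simp [h]
  rw [Finset.sum_eq_zero_iff_of_nonneg
    (fun i _ => by linarith [neg_one_le_quarterCos (c i)])] at h0
  exact eq_two_of_quarterCos _ (by linarith [h0 i (Finset.mem_univ i)])

/-- The quaternary form of the Hadamard condition. -/
structure IsQuaternaryHadamard (Q : AddSubgroup (I → ZMod 4)) : Prop where
  card_eq : Nat.card Q = 4 * Fintype.card I
  cosSum_nonpos : ∀ c ∈ Q, c ≠ 0 → cosSum c ≤ 0

variable {Q : AddSubgroup (I → ZMod 4)}

/-- The `i`-th coordinate as a character. -/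
def coordHom (Q : AddSubgroup (I → ZMod 4)) (i : I) : Q →+ ZMod 4 :=
  (Pi.evalAddMonoidHom _ i).comp Q.subtype

theorem coordHom_apply (i : I) (c : Q) : coordHom Q i c = c.1 i := rfl

variable [Fintype Q] [DecidableEq Q]

theorem IsQuaternaryHadamard.cast_card (h : IsQuaternaryHadamard Q) :
    (Fintype.card Q : ℤ) = 4 * Fintype.card I := by
  have := h.card_eq
  rw [Nat.card_eq_fintype_card] at this
  exact_mod_cast this

/-- Only the zero word contributes positively, so the sum is at most n. A trivial coordinate
character would alone contribute |Q| = 4n, hence all are nontrivial and their sums vanish. -/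
theorem IsQuaternaryHadamard.sum_cosSum [Nonempty I] (h : IsQuaternaryHadamard Q) :
    ∑ c : Q, cosSum c.1 = 0 := by
  have hn : 0 < (Fintype.card I : ℤ) := by exact_mod_cast Fintype.card_pos
  have hle : ∑ c : Q, cosSum c.1 ≤ Fintype.card I := by
    rw [← Finset.add_sum_erase _ _ (Finset.mem_univ (0 : Q))]
    have : ∑ c ∈ Finset.univ.erase (0 : Q), cosSum c.1 ≤ 0 :=
      Finset.sum_nonpos fun c hc =>
        h.cosSum_nonpos c.1 c.2 fun h0 => (Finset.ne_of_mem_erase hc) (Subtype.ext h0)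
    have h0 : cosSum (0 : Q).1 = Fintype.card I := cosSum_zero
    linarith
  have hswap : ∑ c : Q, cosSum c.1 = ∑ i, ∑ c : Q, quarterCos (coordHom Q i c) :=
    Finset.sum_comm
  rw [hswap] at hle ⊢
  refine Finset.sum_eq_zero fun i _ => sum_quarterCos_hom' _ ?_
  refine exists_ne_zero_of_sum_quarterCos _ ?_
  have := Finset.single_le_sum (f := fun i => ∑ c : Q, quarterCos (coordHom Q i c))
    (fun i _ => sum_quarterCos_nonneg (coordHom Q i)) (Finset.mem_univ i)
  have := h.cast_card
  linarith

theorem two_mul_sum_cosSum_sq :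
    2 * ∑ c : Q, cosSum c.1 ^ 2 = ∑ p : I × I,
      (∑ c : Q, quarterCos ((coordHom Q p.1 - coordHom Q p.2) c) +
        ∑ c : Q, quarterCos ((coordHom Q p.1 + coordHom Q p.2) c)) := by
  simp only [← Finset.sum_add_distrib]
  rw [Finset.sum_comm, Finset.mul_sum]
  refine Finset.sum_congr rfl fun c _ => ?_
  rw [Fintype.sum_prod_type, sq, cosSum, Finset.sum_mul_sum, Finset.mul_sum]
  refine Finset.sum_congr rfl fun i _ => ?_
  rw [Finset.mul_sum]
  refine Finset.sum_congr rfl fun j _ => ?_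
  exact two_mul_quarterCos_mul _ _

/-- For c ≠ 0 the value `cosSum c` lies in [−n, 0], so x² + nx ≤ 0 there; the correction 2n² cancels
the zero word. Summing gives the upper bound on the second moment. -/
theorem IsQuaternaryHadamard.excess_nonpos (h : IsQuaternaryHadamard Q) (c : Q) :
    cosSum c.1 ^ 2 + Fintype.card I * cosSum c.1
      - (if c = 0 then 2 * (Fintype.card I : ℤ) ^ 2 else 0) ≤ 0 := by
  split_ifs with hc
  · have h0 : cosSum c.1 = Fintype.card I := by rw [hc]; exact cosSum_zero
    rw [h0]; apply le_of_eq; ring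
  · have h1 := h.cosSum_nonpos c.1 c.2 fun h0 => hc (Subtype.ext h0)
    have h2 := neg_card_le_cosSum c.1
    nlinarith

theorem IsQuaternaryHadamard.sum_excess [Nonempty I] (h : IsQuaternaryHadamard Q) :
    ∑ c : Q, (cosSum c.1 ^ 2 + Fintype.card I * cosSum c.1
      - (if c = 0 then 2 * (Fintype.card I : ℤ) ^ 2 else 0)) =
    ∑ c : Q, cosSum c.1 ^ 2 - 2 * (Fintype.card I : ℤ) ^ 2 := by
  rw [Finset.sum_sub_distrib, Finset.sum_add_distrib, ← Finset.mul_sum, h.sum_cosSum]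
  simp

/-- Character sums are nonnegative, and on the diagonal the trivial difference contributes |Q| = 4n.
Summing gives the lower bound on the second moment. -/
theorem IsQuaternaryHadamard.defect_nonneg [DecidableEq I] (h : IsQuaternaryHadamard Q)
    (p : I × I) :
    0 ≤ ∑ c : Q, quarterCos ((coordHom Q p.1 - coordHom Q p.2) c) +
        ∑ c : Q, quarterCos ((coordHom Q p.1 + coordHom Q p.2) c) -
        (if p.1 = p.2 then 4 * (Fintype.card I : ℤ) else 0) := by
  have h1 := sum_quarterCos_nonneg (coordHom Q p.1 - coordHom Q p.2)
  have h2 := sum_quarterCos_nonneg (coordHom Q p.1 + coordHom Q p.2)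
  split_ifs with hp
  · have h3 := sum_quarterCos_of_trivial (coordHom Q p.1 - coordHom Q p.2)
      (fun g => by simp [hp])
    rw [h.cast_card] at h3
    linarith
  · linarith

theorem IsQuaternaryHadamard.sum_defect [DecidableEq I] :
    ∑ p : I × I, (∑ c : Q, quarterCos ((coordHom Q p.1 - coordHom Q p.2) c) +
        ∑ c : Q, quarterCos ((coordHom Q p.1 + coordHom Q p.2) c) -
        (if p.1 = p.2 then 4 * (Fintype.card I : ℤ) else 0)) =
      2 * ∑ c : Q, cosSum c.1 ^ 2 - 4 * (Fintype.card I : ℤ) ^ 2 := by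
  rw [Finset.sum_sub_distrib, ← two_mul_sum_cosSum_sq, Fintype.sum_prod_type]
  simp
  ring

theorem IsQuaternaryHadamard.sum_cosSum_sq [Nonempty I] (h : IsQuaternaryHadamard Q) :
    ∑ c : Q, cosSum c.1 ^ 2 = 2 * (Fintype.card I : ℤ) ^ 2 := by
  classical
  have h1 := h.sum_excess
  have h2 := IsQuaternaryHadamard.sum_defect (Q := Q)
  have h3 := Finset.sum_nonpos fun c (_ : c ∈ Finset.univ) => h.excess_nonpos c
  have h4 := Finset.sum_nonneg fun p (_ : p ∈ Finset.univ) => h.defect_nonneg p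
  linarith

theorem IsQuaternaryHadamard.defect_eq_zero [Nonempty I] [DecidableEq I]
    (h : IsQuaternaryHadamard Q) (p : I × I) :
    ∑ c : Q, quarterCos ((coordHom Q p.1 - coordHom Q p.2) c) +
        ∑ c : Q, quarterCos ((coordHom Q p.1 + coordHom Q p.2) c) -
        (if p.1 = p.2 then 4 * (Fintype.card I : ℤ) else 0) = 0 := by
  have h2 := IsQuaternaryHadamard.sum_defect (Q := Q)
  rw [h.sum_cosSum_sq] at h2
  refine (Finset.sum_eq_zero_iff_of_nonneg fun p _ => h.defect_nonneg p).1 ?_ p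
    (Finset.mem_univ p)
  rw [h2]; ring

end Moments

/-! ### Consequences of equality for coordinates and words -/

section Columns

variable {I : Type*} [Fintype I] {Q : AddSubgroup (I → ZMod 4)}

theorem IsQuaternaryHadamard.exists_coord_ne [Nonempty I] (h : IsQuaternaryHadamard Q)
    {i j : I} (hij : i ≠ j) : ∃ c ∈ Q, c i ≠ c j := by
  classical
  have := Fintype.ofFinite Q
  have h0 := h.defect_eq_zero (i, j)
  have h2 := sum_quarterCos_nonneg (coordHom Q i + coordHom Q j)
  have hn : 0 < (Fintype.card I : ℤ) := by exact_mod_cast Fintype.card_pos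
  have hc := h.cast_card
  simp only [hij, if_false] at h0
  obtain ⟨c, hc⟩ := exists_ne_zero_of_sum_quarterCos (coordHom Q i - coordHom Q j) (by linarith)
  exact ⟨c.1, c.2, fun h' => hc (by simp [coordHom_apply, h'])⟩

/-- Vanishing defect leaves nothing for the sum of the two characters. The case i = j matters: there
the difference uses up the whole 4n, so no coordinate character is killed by 2. -/
theorem IsQuaternaryHadamard.exists_coord_add_ne_zero [Nonempty I] (h : IsQuaternaryHadamard Q)
    (i j : I) : ∃ c ∈ Q, c i + c j ≠ 0 := by
  classical
  have := Fintype.ofFinite Q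
  have h0 := h.defect_eq_zero (i, j)
  have hn : 0 < (Fintype.card I : ℤ) := by exact_mod_cast Fintype.card_pos
  have hc := h.cast_card
  have h1 := sum_quarterCos_nonneg (coordHom Q i - coordHom Q j)
  obtain ⟨c, hc⟩ := exists_ne_zero_of_sum_quarterCos (coordHom Q i + coordHom Q j) (by
    simp only at h0
    split_ifs at h0 with hij
    · have h3 := sum_quarterCos_of_trivial (coordHom Q i - coordHom Q j)
        (fun g => by simp [hij])
      linarith
    · linarith)
  exact ⟨c.1, c.2, hc⟩

/-- Zero excess forces `cosSum c` to be 0 or −n, and −n occurs only for the constant word 2. Without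
that word the first moment would be n instead of 0. -/
theorem IsQuaternaryHadamard.two_mem [Nonempty I] (h : IsQuaternaryHadamard Q) :
    (fun _ => 2) ∈ Q ∧ ∀ c ∈ Q, c ≠ 0 → c ≠ (fun _ => 2) → cosSum c = 0 := by
  classical
  have := Fintype.ofFinite Q
  have hn : 0 < (Fintype.card I : ℤ) := by exact_mod_cast Fintype.card_pos
  have hz : ∀ c : Q, c ≠ 0 → cosSum c.1 = 0 ∨ c.1 = fun _ => 2 := by
    intro c hc
    have h1 := h.sum_excess
    rw [h.sum_cosSum_sq, sub_self] at h1
    have h2 := (Finset.sum_eq_zero_iff_of_nonpos fun c _ => h.excess_nonpos c).1 h1 c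
      (Finset.mem_univ c)
    simp only [hc, if_false, sub_zero] at h2
    have h3 : cosSum c.1 * (cosSum c.1 + Fintype.card I) = 0 := by linarith
    rcases mul_eq_zero.1 h3 with h4 | h4
    · exact Or.inl h4
    · exact Or.inr (funext fun i => eq_two_of_cosSum (by linarith) i)
  constructor
  · by_contra hmem
    have hs := h.sum_cosSum
    rw [Finset.sum_eq_single (0 : Q)] at hs
    · have h0 : cosSum (0 : Q).1 = Fintype.card I := cosSum_zero
      linarith
    · intro c _ hc
      exact (hz c hc).resolve_right fun h' => hmem (h' ▸ c.2)
    · simp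
  · intro c hc h0 h2
    exact (hz ⟨c, hc⟩ fun h' => h0 (congrArg Subtype.val h')).resolve_right h2

/-- Sum `cosSum` over the subgroup 2Q. If the constant word 2 were not in it, only the zero word
would count, giving n; but every coordinate is nontrivial on 2Q, giving 0. -/
theorem IsQuaternaryHadamard.exists_two_mul_eq [Nonempty I] (h : IsQuaternaryHadamard Q) :
    ∃ w ∈ Q, ∀ i, w i + w i = 2 := by
  classical
  have := Fintype.ofFinite Q
  obtain ⟨hmem, hbal⟩ := h.two_mem
  let D : AddSubgroup Q := (AddMonoidHom.id Q + AddMonoidHom.id Q).range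
  have hn : 0 < (Fintype.card I : ℤ) := by exact_mod_cast Fintype.card_pos
  by_contra! hno
  have hs : ∑ c : D, cosSum c.1.1 = Fintype.card I := by
    rw [Finset.sum_eq_single (0 : D)]
    · exact cosSum_zero
    · rintro ⟨c, q, hq⟩ _ hc
      refine hbal c.1 c.2 (fun h' => hc (Subtype.ext (Subtype.ext h'))) fun h' => ?_
      obtain ⟨i, hi⟩ := hno q.1 q.2
      exact hi (by rw [← congrFun h' i, ← hq]; rfl)
    · simp
  have hs' : ∑ c : D, cosSum c.1.1 =
      ∑ i, ∑ c : D, quarterCos (((coordHom Q i).comp D.subtype) c) := Finset.sum_comm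
  have hs0 : ∑ c : D, cosSum c.1.1 = 0 := by
    rw [hs']
    refine Finset.sum_eq_zero fun i _ => sum_quarterCos_hom' _ ?_
    obtain ⟨c, hc, hci⟩ := h.exists_coord_add_ne_zero i i
    let q : Q := ⟨c, hc⟩
    exact ⟨⟨q + q, q, rfl⟩, hci⟩
  linarith

end Columns

/-! ### Generators of a quaternary code -/

/-- The embedding of `ZMod 2` onto `2 ZMod 4`. -/
def doubleHom : ZMod 2 →+ ZMod 4 :=
  AddMonoidHom.mk' (fun t => if t = 0 then 0 else 2) (by decide)

/-- Reduction modulo `2`. -/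
def reduceHom : ZMod 4 →+* ZMod 2 := ZMod.castHom (by norm_num : 2 ∣ 4) (ZMod 2)

theorem reduceHom_doubleHom : ∀ t, reduceHom (doubleHom t) = 0 := by decide

theorem doubleHom_mul : ∀ t c, doubleHom t * c = doubleHom (t * reduceHom c) := by decide

theorem doubleHom_reduceHom : ∀ c, doubleHom (reduceHom c) = c + c := by decide

theorem eq_zero_of_doubleHom : ∀ t, doubleHom t = 0 → t = 0 := by decide

theorem exists_doubleHom_of_reduceHom : ∀ c, reduceHom c = 0 → ∃ t, c = doubleHom t := by decide

theorem exists_reduceHom_eq : ∀ t, ∃ c, t = reduceHom c := by decide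

theorem ZMod.four_odd_mul_self : ∀ c : ZMod 4, c + c = 2 → c * c = 1 := by decide

theorem reduceHom_eq_one : ∀ c : ZMod 4, c + c = 2 → reduceHom c = 1 := by decide

section LinearAlgebra

variable {K E : Type*} [Field K] [AddCommGroup E] [Module K E] [FiniteDimensional K E]

theorem Submodule.exists_complement_family {W V : Submodule K E} (h : W ≤ V) :
    ∃ (s : ℕ) (u : Fin s → E), (∀ j, u j ∈ V) ∧
      (∀ v ∈ V, ∃ w ∈ W, ∃ t : Fin s → K, v = w + ∑ j, t j • u j) ∧
      ∀ w ∈ W, ∀ t : Fin s → K, w + ∑ j, t j • u j = 0 → w = 0 ∧ t = 0 := by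
  obtain ⟨U, hU⟩ := W.exists_isCompl
  let b := Module.finBasis K (V ⊓ U : Submodule K E)
  have hsum : ∀ t : _ → K, ∑ j, t j • (b j).1 = (∑ j, t j • b j : (V ⊓ U : Submodule K E)).1 := by
    intro t; simp
  refine ⟨_, fun j => (b j).1, fun j => (b j).2.1, fun v hv => ?_, fun w hw t ht => ?_⟩
  · have hv' : v ∈ W ⊔ U := by rw [hU.sup_eq_top]; trivial
    obtain ⟨w, hw, x, hx, rfl⟩ := Submodule.mem_sup.1 hv'
    have hxV : x ∈ V := by simpa using V.sub_mem hv (h hw)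
    refine ⟨w, hw, b.repr ⟨x, hxV, hx⟩, ?_⟩
    rw [hsum, b.sum_repr]
  · rw [hsum] at ht
    have hmem := (∑ j, t j • b j : (V ⊓ U : Submodule K E)).2.2
    have hw0 : w = 0 := by
      refine Submodule.disjoint_def.1 hU.disjoint w hw ?_
      rw [eq_neg_of_add_eq_zero_left ht]
      exact U.neg_mem hmem
    refine ⟨hw0, ?_⟩
    rw [hw0, zero_add] at ht
    exact funext (Fintype.linearIndependent_iff.1 b.linearIndependent t (Subtype.ext ht))

end LinearAlgebra

/-- Coefficient tuples: one quaternary constant, `m` quaternary and `s` binary coefficients. -/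
abbrev Coeffs (m s : ℕ) : Type := ZMod 4 × (Fin m → ZMod 4) × (Fin s → ZMod 2)

/-- The word `a w + ∑ j, b j g j + 2 ∑ j, t j u j`. -/
def comboWord {I : Type*} {m s : ℕ} (w : I → ZMod 4) (g : Fin m → I → ZMod 4)
    (u : Fin s → I → ZMod 2) : Coeffs m s →+ (I → ZMod 4) :=
  AddMonoidHom.mk' (fun p i => p.1 * w i + ∑ j, p.2.1 j * g j i + doubleHom (∑ j, p.2.2 j * u j i))
    (by
      intro p q
      funext i
      simp only [Prod.fst_add, Prod.snd_add, Pi.add_apply, add_mul, Finset.sum_add_distrib,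
        map_add]
      abel)

theorem comboWord_apply {I : Type*} {m s : ℕ} (w : I → ZMod 4) (g : Fin m → I → ZMod 4)
    (u : Fin s → I → ZMod 2) (p : Coeffs m s) (i : I) : comboWord w g u p i =
      p.1 * w i + ∑ j, p.2.1 j * g j i + doubleHom (∑ j, p.2.2 j * u j i) := rfl

theorem comboWord_mem {I : Type*} {m s : ℕ} {Q : AddSubgroup (I → ZMod 4)} {w : I → ZMod 4}
    {g : Fin m → I → ZMod 4} {u : Fin s → I → ZMod 2} (hw : w ∈ Q) (hg : ∀ j, g j ∈ Q)
    (hu : ∀ j, doubleHom ∘ u j ∈ Q) (p : Coeffs m s) : comboWord w g u p ∈ Q := by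
  have hsmul : ∀ (a : ZMod 4) (q : I → ZMod 4), q ∈ Q → a • q ∈ Q := fun a q hq =>
    ((AddSubgroup.toZModSubmodule 4) Q).smul_mem a hq
  have hd : ∀ (t : ZMod 2) (v : I → ZMod 2), doubleHom ∘ v ∈ Q → doubleHom ∘ (t • v) ∈ Q := by
    intro t v hv
    obtain rfl | rfl : t = 0 ∨ t = 1 := by revert t; decide
    · convert Q.zero_mem
      funext i; simp
    · simpa using hv
  have heq : comboWord w g u p =
      p.1 • w + ∑ j, p.2.1 j • g j + ∑ j, doubleHom ∘ (p.2.2 j • u j) := by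
    funext i
    simp [comboWord_apply, map_sum]
  rw [heq]
  exact Q.add_mem (Q.add_mem (hsmul _ _ hw) (Q.sum_mem fun j _ => hsmul _ _ (hg j)))
    (Q.sum_mem fun j _ => hd _ _ (hu j))

/-- With W = Q mod 2 and V = {v : 2v ∈ Q} there is a chain ⟨1⟩ ≤ W ≤ V of binary spaces. Lifts of a
complement of ⟨1⟩ in W give the quaternary generators, and a complement of W in V gives the binary
ones. -/
theorem AddSubgroup.exists_comboWord {I : Type*} [Fintype I] [Nonempty I]
    (Q : AddSubgroup (I → ZMod 4)) {w : I → ZMod 4} (hwQ : w ∈ Q) (hw : ∀ i, w i + w i = 2) :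
    ∃ (m s : ℕ) (g : Fin m → I → ZMod 4) (u : Fin s → I → ZMod 2),
      Function.Injective (comboWord w g u) ∧ (comboWord w g u).range = Q := by
  let R : (I → ZMod 4) →+ (I → ZMod 2) := reduceHom.toAddMonoidHom.compLeft I
  let D : (I → ZMod 2) →+ (I → ZMod 4) := doubleHom.compLeft I
  have hDR : ∀ q, D (R q) = q + q := fun q => funext fun i => doubleHom_reduceHom _
  let W : Submodule (ZMod 2) (I → ZMod 2) := AddSubgroup.toZModSubmodule 2 (Q.map R)
  let V : Submodule (ZMod 2) (I → ZMod 2) := AddSubgroup.toZModSubmodule 2 (Q.comap D)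
  have hWmem : ∀ x, x ∈ W ↔ ∃ q ∈ Q, R q = x := fun x => Iff.rfl
  have hVmem : ∀ x, x ∈ V ↔ D x ∈ Q := fun x => Iff.rfl
  have hWV : W ≤ V := by
    rintro x ⟨q, hq, rfl⟩
    rw [hVmem, hDR]
    exact Q.add_mem hq hq
  have hRw : R w = 1 := funext fun i => reduceHom_eq_one _ (hw i)
  have hL : Submodule.span (ZMod 2) {(1 : I → ZMod 2)} ≤ W := by
    rw [Submodule.span_singleton_le_iff_mem]
    exact ⟨w, hwQ, hRw⟩
  obtain ⟨m, g', hg'W, hg'span, hg'ind⟩ := Submodule.exists_complement_family hL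
  obtain ⟨s, u, huV, huspan, huind⟩ := Submodule.exists_complement_family hWV
  choose g hgQ hgR using hg'W
  have hWspan : ∀ v ∈ W, ∃ (α : ZMod 2) (β : Fin m → ZMod 2), ∀ i, v i = α + ∑ j, β j * g' j i := by
    intro v hv
    obtain ⟨x, hx, β, h⟩ := hg'span v hv
    obtain ⟨α, rfl⟩ := Submodule.mem_span_singleton.1 hx
    exact ⟨α, β, fun i => by simp [h]⟩
  have hgRi : ∀ j i, reduceHom (g j i) = g' j i := fun j i => congrFun (hgR j) i
  have hWind : ∀ (α : ZMod 2) (β : Fin m → ZMod 2), (∀ i, α + ∑ j, β j * g' j i = 0) →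
      α = 0 ∧ β = 0 := by
    intro α β h
    obtain ⟨h1, h2⟩ := hg'ind (α • 1) (Submodule.smul_mem _ _ (Submodule.mem_span_singleton_self _))
      β (funext fun i => by simpa using h i)
    obtain ⟨i⟩ := ‹Nonempty I›
    exact ⟨by simpa using congrFun h1 i, h2⟩
  have hdouble : ∀ (α : ZMod 2) (β : Fin m → ZMod 2) (t : Fin s → ZMod 2) (i : I),
      comboWord w g u (doubleHom α, doubleHom ∘ β, t) i =
        doubleHom (α + ∑ j, β j * g' j i + ∑ j, t j * u j i) := by
    intro α β t i
    have h1 : reduceHom (w i) = 1 := congrFun hRw i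
    simp [comboWord_apply, doubleHom_mul, hgRi, h1, map_sum]
  have hmem := comboWord_mem (m := m) (s := s) hwQ hgQ huV
  refine ⟨m, s, g, u, (injective_iff_map_eq_zero _).2 ?_, le_antisymm ?_ ?_⟩
  · rintro ⟨a, b, t⟩ hp
    -- Reduction mod 2 shows that all quaternary coefficients are even; halving the relation turns
    -- it into one inside V.
    have hred := hWind (reduceHom a) (fun j => reduceHom (b j)) fun i => by
      have h := congrArg reduceHom (congrFun hp i)
      have h1 : reduceHom (w i) = 1 := congrFun hRw i
      simpa [comboWord_apply, reduceHom_doubleHom, h1, hgRi, map_sum] using h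
    obtain ⟨α, rfl⟩ := exists_doubleHom_of_reduceHom _ hred.1
    choose β hβ using fun j => exists_doubleHom_of_reduceHom _ (congrFun hred.2 j)
    obtain rfl : b = doubleHom ∘ β := funext hβ
    have h0 : ∀ i, α + ∑ j, β j * g' j i + ∑ j, t j * u j i = 0 := fun i =>
      eq_zero_of_doubleHom _ (by rw [← hdouble, hp]; rfl)
    have hx : (fun i => α + ∑ j, β j * g' j i) ∈ W := by
      have : (fun i => α + ∑ j, β j * g' j i) = α • R w + ∑ j, β j • R (g j) := by
        funext i
        simp [hRw, hgR]
      rw [this]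
      exact W.add_mem (W.smul_mem _ ⟨w, hwQ, rfl⟩)
        (W.sum_mem fun j _ => W.smul_mem _ ⟨g j, hgQ j, rfl⟩)
    obtain ⟨h1, rfl⟩ := huind _ hx t (funext fun i => by simpa using h0 i)
    obtain ⟨rfl, rfl⟩ := hWind α β (congrFun h1)
    ext <;> simp
  · rintro _ ⟨p, rfl⟩
    exact hmem p
  · intro q hq
    obtain ⟨α, β, h⟩ := hWspan (R q) ⟨q, hq, rfl⟩
    obtain ⟨a, rfl⟩ := exists_reduceHom_eq α
    choose b hb using fun j => exists_reduceHom_eq (β j)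
    -- After subtracting a combination with the same reduction mod 2, the remainder is 2v with v in
    -- V.
    obtain ⟨r, hr⟩ : ∃ r, r = q - comboWord w g u (a, b, 0) := ⟨_, rfl⟩
    have hrQ : r ∈ Q := hr ▸ Q.sub_mem hq (hmem _)
    have hr0 : ∀ i, reduceHom (r i) = 0 := by
      intro i
      have h1 : reduceHom (w i) = 1 := congrFun hRw i
      have h2 : reduceHom (q i) = _ := h i
      simp [hr, comboWord_apply, h1, h2, hgRi, hb, map_sum]
    choose v hv using fun i => exists_doubleHom_of_reduceHom _ (hr0 i)
    have hvV : v ∈ V := by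
      rw [hVmem]
      convert hrQ
      exact (funext hv).symm
    obtain ⟨x, hx, t, hxt⟩ := huspan v hvV
    obtain ⟨α', β', h'⟩ := hWspan x hx
    refine ⟨(a, b, 0) + (doubleHom α', doubleHom ∘ β', t), ?_⟩
    rw [map_add, ← eq_sub_iff_add_eq', ← hr]
    funext i
    rw [hdouble, hv, hxt]
    simp [h']

/-! ### Reduction to codes of affine functions -/

/-- Evaluation points of quaternary affine functions. -/
abbrev AffinePoint (m s : ℕ) : Type := (Fin m → ZMod 4) × (Fin s → ZMod 2)

/-- The word of values of `(x, y) ↦ a + ∑ j, b j x j + 2 ∑ j, t j y j`. -/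
def affineWord (m s : ℕ) : Coeffs m s →+ (AffinePoint m s → ZMod 4) :=
  comboWord 1 (fun j x => x.1 j) (fun j x => x.2 j)

theorem affineWord_apply {m s : ℕ} (p : Coeffs m s) (x : AffinePoint m s) : affineWord m s p x =
    p.1 + ∑ j, p.2.1 j * x.1 j + doubleHom (∑ j, p.2.2 j * x.2 j) := by
  simp [affineWord, comboWord_apply]

/-- The Gray map with coordinates indexed by a sum type. -/
def graySum {I : Type*} (c : I → ZMod 4) : I ⊕ I → ZMod 2 :=
  Sum.elim (fun i => grayBeta (c i)) (fun i => grayGamma (c i))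

/-- `C` is, up to a bijection of coordinates, the Gray image of the code of affine functions on
`Z₄^m × Z₂^s`. -/
def HasAffineType {J : Type*} (C : Set (J → ZMod 2)) (m s : ℕ) : Prop :=
  ∃ e : J ≃ AffinePoint m s ⊕ AffinePoint m s,
    C = Set.range fun p => graySum (affineWord m s p) ∘ e

/-- The permutation exchanging the two copies of `i` whenever `w i ≠ 1`. -/
def signSwap {I : Type*} (w : I → ZMod 4) : I ⊕ I ≃ I ⊕ I :=
  Function.Involutive.toPerm
    (Sum.elim (fun i => if w i = 1 then Sum.inl i else Sum.inr i)
      (fun i => if w i = 1 then Sum.inr i else Sum.inl i))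
    (by rintro (i | i) <;> by_cases h : w i = 1 <;> simp [h])

theorem signSwap_inl {I : Type*} (w : I → ZMod 4) (i : I) :
    signSwap w (Sum.inl i) = if w i = 1 then Sum.inl i else Sum.inr i := rfl

theorem signSwap_inr {I : Type*} (w : I → ZMod 4) (i : I) :
    signSwap w (Sum.inr i) = if w i = 1 then Sum.inr i else Sum.inl i := rfl

theorem grayBeta_odd_mul : ∀ w c : ZMod 4, w + w = 2 →
    grayBeta c = if w = 1 then grayBeta (w * c) else grayGamma (w * c) := by decide

theorem grayGamma_odd_mul : ∀ w c : ZMod 4, w + w = 2 →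
    grayGamma c = if w = 1 then grayGamma (w * c) else grayBeta (w * c) := by decide

/-- Negation in Z₄ exchanges `grayBeta` and `grayGamma`, so changing signs of coordinates only
permutes Gray coordinates. -/
theorem graySum_mul_comp_signSwap {I : Type*} {w : I → ZMod 4} (hw : ∀ i, w i + w i = 2)
    (c : I → ZMod 4) : graySum (w * c) ∘ signSwap w = graySum c := by
  funext x
  rcases x with i | i
  · have := grayBeta_odd_mul (w i) (c i) (hw i)
    by_cases h : w i = 1 <;> simp_all [signSwap_inl, graySum]
  · have := grayGamma_odd_mul (w i) (c i) (hw i)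
    by_cases h : w i = 1 <;> simp_all [signSwap_inr, graySum]

theorem ZMod.four_odd_eq_or_neg : ∀ a b : ZMod 4, a + a = 2 → b + b = 2 → a = b ∨ a = -b := by
  decide

theorem ZMod.four_odd_mul_doubleHom : ∀ (w : ZMod 4) (t : ZMod 2), w + w = 2 →
    w * doubleHom t = doubleHom t := by decide

theorem IsQuaternaryHadamard.hasAffineType {I J : Type*} [Fintype I] [Nonempty I]
    {Q : AddSubgroup (I → ZMod 4)} (h : IsQuaternaryHadamard Q) (e : J ≃ I ⊕ I) :
    ∃ m s, HasAffineType ((fun c => graySum c ∘ e) '' (Q : Set (I → ZMod 4))) m s := by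
  obtain ⟨w, hwQ, hw⟩ := h.exists_two_mul_eq
  obtain ⟨m, s, g, u, hinj, hrange⟩ := Q.exists_comboWord hwQ hw
  -- The column of the generator matrix at i, normalized by w i = ±1 so that the entry of w becomes
  -- 1.
  let κ : I → AffinePoint m s := fun i => (fun j => w i * g j i, fun j => u j i)
  have hww : ∀ i, w i * w i = 1 := fun i => ZMod.four_odd_mul_self _ (hw i)
  have hκ : ∀ p i, w i * comboWord w g u p i = affineWord m s p (κ i) := by
    intro p i
    rw [affineWord_apply, comboWord_apply, mul_add, mul_add, ZMod.four_odd_mul_doubleHom _ _ (hw i),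
      mul_left_comm, hww, mul_one, Finset.mul_sum]
    simp only [κ, mul_left_comm]
  have hκinj : Function.Injective κ := by
    intro i j hij
    by_contra hne
    have hq : ∀ q ∈ Q, w i * q i = w j * q j := by
      intro q hq
      rw [← hrange] at hq
      obtain ⟨p, rfl⟩ := hq
      rw [hκ, hκ, hij]
    rcases ZMod.four_odd_eq_or_neg _ _ (hw i) (hw j) with hs | hs
    · obtain ⟨c, hc, hne⟩ := h.exists_coord_ne hne
      refine hne ?_
      have := congrArg (w i * ·) (hq c hc)
      simpa only [← hs, ← mul_assoc, hww, one_mul] using this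
    · obtain ⟨c, hc, hne⟩ := h.exists_coord_add_ne_zero i j
      refine hne ?_
      have := congrArg (w j * ·) (hq c hc)
      simp only [hs, neg_mul, mul_neg, ← mul_assoc, hww, one_mul] at this
      rw [← this, add_neg_cancel]
  -- Both sides times 4 equal |Q|, the factor 4 on the right coming from the constant coefficient.
  have hcard : Fintype.card I = Fintype.card (AffinePoint m s) := by
    have h1 := h.card_eq
    rw [← hrange, ← Nat.card_congr (AddMonoidHom.ofInjective hinj).toEquiv, Nat.card_prod,
      Nat.card_zmod] at h1
    rw [← Nat.card_eq_fintype_card (α := AffinePoint m s)]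
    exact (Nat.eq_of_mul_eq_mul_left (by norm_num) h1).symm
  let κ' : I ≃ AffinePoint m s := Equiv.ofBijective κ
    ((Fintype.bijective_iff_injective_and_card κ).2 ⟨hκinj, hcard⟩)
  refine ⟨m, s, (e.trans (signSwap w)).trans (Equiv.sumCongr κ' κ'), ?_⟩
  rw [← hrange, AddMonoidHom.coe_range, ← Set.range_comp]
  congr 1
  funext p x
  have h1 : w * comboWord w g u p = affineWord m s p ∘ κ' := funext fun i => hκ p i
  have h2 := congrFun (graySum_mul_comp_signSwap hw (comboWord w g u p)) (e x)
  rw [h1] at h2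
  simp only [Function.comp_apply, Equiv.trans_apply, ← h2]
  rcases signSwap w (e x) with i | i <;> rfl

/-! ### The Gray isometry; affine codes are Hadamard -/

section GrayIsometry

theorem hammingDist_comp_equiv {J J' : Type*} [Fintype J] [Fintype J'] (e : J ≃ J')
    (x y : J' → ZMod 2) : hammingDist (x ∘ e) (y ∘ e) = hammingDist x y :=
  Finset.card_equiv e (by simp)

theorem grayBeta_ne_add_grayGamma_ne : ∀ a b : ZMod 4,
    (if grayBeta a ≠ grayBeta b then 1 else 0) + (if grayGamma a ≠ grayGamma b then 1 else 0) =
      1 - quarterCos (a - b) := by decide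

theorem hammingDist_graySum {I : Type*} [Fintype I] (a b : I → ZMod 4) :
    (hammingDist (graySum a) (graySum b) : ℤ) = Fintype.card I - cosSum (a - b) := by
  rw [hammingDist, Finset.card_filter, Fintype.sum_sum_type]
  push_cast
  rw [← Finset.sum_add_distrib, cosSum]
  have : (Fintype.card I : ℤ) = ∑ _i : I, 1 := by simp
  rw [this, ← Finset.sum_sub_distrib]
  exact Finset.sum_congr rfl fun i _ => grayBeta_ne_add_grayGamma_ne (a i) (b i)

theorem ZMod.four_ext_gray : ∀ a b : ZMod 4, grayBeta a = grayBeta b →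
    grayGamma a = grayGamma b → a = b := by decide

theorem graySum_injective {I : Type*} :
    Function.Injective (graySum : (I → ZMod 4) → I ⊕ I → ZMod 2) := fun _ _ h =>
  funext fun i => ZMod.four_ext_gray _ _ (congrFun h (Sum.inl i)) (congrFun h (Sum.inr i))

theorem grayMap_eq_graySum_comp {n : ℕ} (c : Fin n → ZMod 4) :
    grayMap c = graySum c ∘ finSumFinEquiv.symm := by
  funext x
  refine Fin.addCases (fun i => ?_) (fun i => ?_) x
  · rw [grayMap, Fin.append_left, Function.comp_apply, finSumFinEquiv_symm_apply_castAdd]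
    rfl
  · rw [grayMap, Fin.append_right, Function.comp_apply, finSumFinEquiv_symm_apply_natAdd]
    rfl

theorem comp_equiv_injective {J J' α : Type*} (e : J ≃ J') :
    Function.Injective (fun x : J' → α => x ∘ e) :=
  e.surjective.injective_comp_right

end GrayIsometry

section AffineCode

variable {m s : ℕ}

theorem affineWord_injective : Function.Injective (affineWord m s) := by
  refine (injective_iff_map_eq_zero _).2 ?_
  rintro ⟨a, b, t⟩ h
  have ha : a = 0 := by
    have := congrFun h (0, 0)
    rw [affineWord_apply] at this
    simpa using this
  subst ha
  have hb : b = 0 := by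
    funext j
    have := congrFun h (Pi.single j 1, 0)
    rw [affineWord_apply] at this
    simpa [Pi.single_apply] using this
  have ht : t = 0 := by
    funext j
    have := congrFun h (0, Pi.single j 1)
    rw [affineWord_apply] at this
    exact eq_zero_of_doubleHom _ (by simpa [Pi.single_apply] using this)
  rw [hb, ht]
  rfl

theorem quarterCos_nonpos : ∀ a, a ≠ 0 → quarterCos a ≤ 0 := by decide

/-- A nonconstant affine function has character sum zero; for a nonzero constant every term is at
most 0. -/
theorem cosSum_affineWord_nonpos (p : Coeffs m s) (hp : affineWord m s p ≠ 0) :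
    cosSum (affineWord m s p) ≤ 0 := by
  let χ : AffinePoint m s →+ ZMod 4 := AddMonoidHom.mk'
    (fun x => ∑ j, p.2.1 j * x.1 j + doubleHom (∑ j, p.2.2 j * x.2 j)) (by
      intro x y
      simp only [Prod.fst_add, Prod.snd_add, Pi.add_apply, mul_add, Finset.sum_add_distrib, map_add]
      abel)
  have hχ : ∀ x, affineWord m s p x = p.1 + χ x := fun x => by
    rw [affineWord_apply, add_assoc]; rfl
  by_cases h : ∃ x, χ x ≠ 0
  · simp only [cosSum, hχ]
    exact (sum_quarterCos_hom χ h _).le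
  · push Not at h
    have h0 : p.1 ≠ 0 := fun h0 => hp (funext fun x => by rw [hχ, h, h0]; rfl)
    refine Finset.sum_nonpos fun x _ => ?_
    rw [hχ, h, add_zero]
    exact quarterCos_nonpos _ h0

theorem card_affinePoint (m s : ℕ) : Fintype.card (AffinePoint m s) = 2 ^ (2 * m + s) := by
  rw [← Nat.card_eq_fintype_card]
  simp [pow_add, pow_mul]

theorem card_coeffs (m s : ℕ) : Nat.card (Coeffs m s) = 4 * 2 ^ (2 * m + s) := by
  simp [pow_add, pow_mul]

theorem HasAffineType.card_eq {N : ℕ} {C : BinaryCode N} (h : HasAffineType C m s) :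
    N = 2 ^ (2 * m + s + 1) := by
  obtain ⟨e, -⟩ := h
  have := Fintype.card_congr e
  rw [Fintype.card_sum, card_affinePoint, Fintype.card_fin] at this
  rw [this, pow_succ]; ring

theorem HasAffineType.isHadamardCode {N : ℕ} {C : BinaryCode N} (h : HasAffineType C m s) :
    IsHadamardCode C := by
  have hN := h.card_eq
  obtain ⟨e, rfl⟩ := h
  refine ⟨?_, ?_⟩
  · rw [← Nat.card_coe_set_eq, ← Nat.card_congr (Equiv.ofInjective _ _), card_coeffs, hN, pow_succ]
    · ring
    · exact (comp_equiv_injective e).comp (graySum_injective.comp affineWord_injective)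
  · rintro _ ⟨p, rfl⟩ _ ⟨q, rfl⟩ hne
    simp only
    rw [hammingDist_comp_equiv]
    have h1 := hammingDist_graySum (affineWord m s p) (affineWord m s q)
    have h2 : cosSum (affineWord m s (p - q)) ≤ 0 := cosSum_affineWord_nonpos _ fun h0 => by
      rw [map_sub, sub_eq_zero] at h0
      exact hne (by simp only [h0])
    rw [map_sub] at h2
    rw [card_affinePoint] at h1
    have h3 : N / 2 = 2 ^ (2 * m + s) := by rw [hN, pow_succ]; simp
    rw [h3]
    zify
    push_cast at h1
    linarith

theorem HasAffineType.isZ4Linear {N : ℕ} {C : BinaryCode N} (h : HasAffineType C m s) :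
    IsZ4Linear C := by
  obtain ⟨e, rfl⟩ := h
  let f := Fintype.equivFin (AffinePoint m s)
  let F : (AffinePoint m s → ZMod 4) →+ (Fin _ → ZMod 4) :=
    AddMonoidHom.mk' (fun c => c ∘ f.symm) fun _ _ => rfl
  refine ⟨_, (F.comp (affineWord m s)).range, (e.trans (Equiv.sumCongr f f)).trans finSumFinEquiv,
    ?_⟩
  rw [AddMonoidHom.coe_range, ← Set.range_comp]
  congr 1
  funext p x
  simp only [Function.comp_apply, grayMap_eq_graySum_comp, Equiv.trans_apply,
    Equiv.symm_apply_apply]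
  rcases e x with i | i <;> simp [graySum, F]

theorem exists_hasAffineType_of_isHadamardCode {N : ℕ} (hN : 0 < N) {C : BinaryCode N}
    (hZ : IsZ4Linear C) (hH : IsHadamardCode C) : ∃ m s, HasAffineType C m s := by
  obtain ⟨n, Q, π, rfl⟩ := hZ
  have hn : N = n + n := by simpa using Fintype.card_congr π
  let e : Fin N ≃ Fin n ⊕ Fin n := π.trans finSumFinEquiv.symm
  have hC : (fun c : Fin n → ZMod 4 => grayMap c ∘ π) = fun c => graySum c ∘ e := by
    funext c
    rw [grayMap_eq_graySum_comp]
    rfl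
  rw [hC] at hH ⊢
  have hinj : Function.Injective fun c : Fin n → ZMod 4 => graySum c ∘ e :=
    (comp_equiv_injective e).comp graySum_injective
  have : Nonempty (Fin n) := ⟨⟨0, by omega⟩⟩
  refine IsQuaternaryHadamard.hasAffineType (Q := Q) ⟨?_, fun c hc h0 => ?_⟩ e
  · have := hH.1
    rw [Set.ncard_image_of_injective _ hinj] at this
    rw [Fintype.card_fin]
    change Nat.card (Q : Set (Fin n → ZMod 4)) = _
    rw [Nat.card_coe_set_eq, this]
    omega
  · have h1 := hH.2 _ ⟨c, hc, rfl⟩ _ ⟨0, Q.zero_mem, rfl⟩ (hinj.ne h0)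
    simp only at h1
    rw [hammingDist_comp_equiv] at h1
    have h2 := hammingDist_graySum c 0
    rw [sub_zero, Fintype.card_fin] at h2
    omega

end AffineCode

/-! ### Types of rank 0 and 1 coincide -/

section LowRank

theorem grayBeta_add_doubleHom : ∀ c t, grayBeta (c + doubleHom t) = grayBeta c + t := by decide

theorem grayGamma_add_doubleHom : ∀ c t, grayGamma (c + doubleHom t) = grayGamma c + t := by decide

/-- The second bit of a quaternary digit. -/
def highBit (x : ZMod 4) : ZMod 2 := grayBeta x

theorem bits_injective : ∀ x y : ZMod 4, reduceHom x = reduceHom y →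
    highBit x = highBit y → x = y := by
  decide

theorem grayBeta_linear : ∀ a b x : ZMod 4, grayBeta (a + b * x) =
    grayBeta a + ((highBit b + reduceHom a * reduceHom b) * reduceHom x
      + reduceHom b * highBit x) := by
  decide

theorem grayGamma_linear : ∀ a b x : ZMod 4, grayGamma (a + b * x) =
    grayGamma a + ((highBit b + reduceHom a * reduceHom b) * reduceHom x
      + reduceHom b * (highBit x + reduceHom x)) := by
  decide

theorem exists_bits : ∀ (a : ZMod 4) (t₀ t₁ : ZMod 2),
    ∃ b : ZMod 4, reduceHom b = t₁ ∧ highBit b + reduceHom a * reduceHom b = t₀ := by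
  decide

/-- Coordinate bijection linearizing the affine code of rank one. -/
def linearizePoint (s : ℕ) : AffinePoint 1 s ⊕ AffinePoint 1 s →
    AffinePoint 0 (s + 2) ⊕ AffinePoint 0 (s + 2) :=
  Sum.map (fun x => (0, Fin.cons (reduceHom (x.1 0)) (Fin.cons (highBit (x.1 0)) x.2)))
    (fun x => (0, Fin.cons (reduceHom (x.1 0))
      (Fin.cons (highBit (x.1 0) + reduceHom (x.1 0)) x.2)))

theorem linearizePoint_bijective (s : ℕ) : Function.Bijective (linearizePoint s) := by
  refine (Fintype.bijective_iff_injective_and_card _).2 ⟨?_, ?_⟩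
  · refine Function.Injective.sumMap ?_ ?_
    · rintro ⟨x, y⟩ ⟨x', y'⟩ h
      simp only [Prod.mk.injEq, true_and, Fin.cons_inj] at h
      obtain ⟨h1, h2, rfl⟩ := h
      refine Prod.ext (funext fun j => ?_) rfl
      rw [Subsingleton.elim j 0]
      exact bits_injective _ _ h1 h2
    · rintro ⟨x, y⟩ ⟨x', y'⟩ h
      simp only [Prod.mk.injEq, true_and, Fin.cons_inj] at h
      obtain ⟨h1, h2, rfl⟩ := h
      refine Prod.ext (funext fun j => ?_) rfl
      rw [Subsingleton.elim j 0]
      rw [h1, add_left_inj] at h2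
      exact bits_injective _ _ h1 h2
  · simp only [Fintype.card_sum, card_affinePoint]
    congr 2 <;> ring

/-- With one quaternary variable, each Gray bit of a + bx is the bit of a plus a linear form in two
bits of x. The coefficients depend on a, but for each fixed a they still run over all pairs, so the
whole code is linear. -/
theorem HasAffineType.rank_one {J : Type*} {C : Set (J → ZMod 2)} {s : ℕ}
    (h : HasAffineType C 0 (s + 2)) : HasAffineType C 1 s := by
  obtain ⟨e, rfl⟩ := h
  let f := Equiv.ofBijective _ (linearizePoint_bijective s)
  have key : ∀ (a b : ZMod 4) (t : Fin s → ZMod 2),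
      graySum (affineWord 1 s (a, fun _ => b, t)) =
        graySum (affineWord 0 (s + 2) (a, 0, Fin.cons (highBit b + reduceHom a * reduceHom b)
          (Fin.cons (reduceHom b) t))) ∘ f := by
    intro a b t
    funext x
    rcases x with x | x
    · simp [f, graySum, linearizePoint, affineWord_apply, Fin.sum_univ_succ, grayBeta_add_doubleHom,
        grayBeta_linear, -map_add, -map_sum]
      ring
    · simp [f, graySum, linearizePoint, affineWord_apply, Fin.sum_univ_succ,
        grayGamma_add_doubleHom, grayGamma_linear, -map_add, -map_sum]
      ring
  refine ⟨e.trans f.symm, Set.Subset.antisymm ?_ ?_⟩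
  · rintro _ ⟨⟨a, b, t⟩, rfl⟩
    obtain ⟨b', h1, h0⟩ := exists_bits a (t 0) (t 1)
    refine ⟨(a, fun _ => b', fun j => t j.succ.succ), ?_⟩
    simp only
    have ht : (Fin.cons (t 0) (Fin.cons (t 1) fun j => t j.succ.succ) : Fin (s + 2) → ZMod 2) =
        t := funext fun j => Fin.cases rfl (fun j => Fin.cases rfl (fun j => rfl) j) j
    rw [key, h0, h1, ht, Subsingleton.elim b 0]
    funext x
    simp
  · rintro _ ⟨⟨a, b, t⟩, rfl⟩
    obtain ⟨b, rfl⟩ : ∃ b₀, b = fun _ => b₀ :=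
      ⟨b 0, funext fun j => by rw [Subsingleton.elim j 0]⟩
    refine ⟨(a, 0, Fin.cons (highBit b + reduceHom a * reduceHom b)
      (Fin.cons (reduceHom b) t)), ?_⟩
    simp only
    rw [key]
    funext x
    simp

end LowRank

/-! ### The translation kernel -/

section Kernel

/-- The words whose translations map `C` into itself. -/
def translationKernel {J : Type*} (C : Set (J → ZMod 2)) : Set (J → ZMod 2) :=
  {v | ∀ x ∈ C, v + x ∈ C}

theorem ncard_translationKernel_image {J J' : Type*} (e : J ≃ J') (y : J' → ZMod 2)
    (C : Set (J' → ZMod 2)) :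
    (translationKernel ((fun x => (x + y) ∘ e) '' C)).ncard = (translationKernel C).ncard := by
  have hinj : Function.Injective fun x : J' → ZMod 2 => (x + y) ∘ e :=
    (comp_equiv_injective e).comp (add_left_injective y)
  rw [← Set.ncard_image_of_injective (translationKernel C) (comp_equiv_injective e)]
  congr 1
  ext v
  obtain ⟨v, rfl⟩ : ∃ v', v = v' ∘ e := ⟨v ∘ e.symm, by funext; simp⟩
  rw [(comp_equiv_injective e).mem_set_image]
  have : ∀ x, v ∘ e + (x + y) ∘ e = ((v + x) + y) ∘ e := fun x => by
    funext j; simp [add_assoc]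
  simp only [translationKernel, Set.mem_ofPred_eq, Set.forall_mem_image, this]
  exact forall₂_congr fun x _ => hinj.mem_set_image

theorem gray_add : ∀ a b : ZMod 4,
    grayBeta a + grayBeta b = grayBeta (a + b + (a + a) * b) ∧
    grayGamma a + grayGamma b = grayGamma (a + b + (a + a) * b) := by decide

/-- Binary addition of Gray images is quaternary addition with the correction 2ab, so kernel
membership asks whether 2ab stays in the code. -/
theorem graySum_add {I : Type*} (a b : I → ZMod 4) :
    graySum a + graySum b = graySum (a + b + (a + a) * b) := by
  funext x
  rcases x with i | i
  · exact (gray_add (a i) (b i)).1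
  · exact (gray_add (a i) (b i)).2

variable {m s : ℕ}

/-- Coefficients of the affine words that are constant modulo `2`. -/
def evenCoeffs (m s : ℕ) (p : ZMod 4 × (Fin m → ZMod 2) × (Fin s → ZMod 2)) : Coeffs m s :=
  (p.1, doubleHom ∘ p.2.1, p.2.2)

theorem doubleHom_injective : Function.Injective doubleHom :=
  (injective_iff_map_eq_zero _).2 eq_zero_of_doubleHom

theorem evenCoeffs_injective : Function.Injective (evenCoeffs m s) := by
  rintro ⟨a, b, t⟩ ⟨a', b', t'⟩ h
  simp only [evenCoeffs, Prod.mk.injEq] at h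
  obtain ⟨rfl, h, rfl⟩ := h
  rw [doubleHom_injective.comp_left h]

theorem ncard_range_evenCoeffs :
    (Set.range fun p => graySum (affineWord m s (evenCoeffs m s p))).ncard =
    2 ^ (m + s + 2) := by
  change (Set.range (graySum ∘ affineWord m s ∘ evenCoeffs m s)).ncard = _
  rw [← Nat.card_coe_set_eq, ← Nat.card_congr (Equiv.ofInjective _
    (graySum_injective.comp (affineWord_injective.comp evenCoeffs_injective)))]
  simp [pow_add]
  ring

theorem doubleHom_add_self : ∀ t, doubleHom t + doubleHom t = 0 := by decide

/-- Twice a word that is constant mod 2 is constant, so the correction 2ab is a scalar multiple of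
b. -/
theorem range_evenCoeffs_subset :
    (Set.range fun p => graySum (affineWord m s (evenCoeffs m s p))) ⊆
    translationKernel (Set.range fun p => graySum (affineWord m s p)) := by
  rintro _ ⟨r, rfl⟩ _ ⟨q, rfl⟩
  simp only
  rw [graySum_add]
  have h1 : (affineWord m s (evenCoeffs m s r) + affineWord m s (evenCoeffs m s r)) *
      affineWord m s q = (r.1 + r.1) • affineWord m s q := by
    have : evenCoeffs m s r + evenCoeffs m s r = (r.1 + r.1, 0, 0) :=
      Prod.ext rfl (Prod.ext (funext fun j => doubleHom_add_self _)
        (funext fun j => CharTwo.add_self_eq_zero _))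
    rw [← map_add, this]
    funext x
    simp [affineWord_apply]
  have h2 : (r.1 + r.1) • affineWord m s q ∈ (affineWord m s).range :=
    (AddSubgroup.toZModSubmodule 4 (affineWord m s).range).smul_mem _ ⟨q, rfl⟩
  rw [h1]
  obtain ⟨c, hc⟩ := h2
  exact ⟨evenCoeffs m s r + q + c, by simp only [map_add, hc]⟩

theorem reduceHom_eq_zero_of_add_self : ∀ c : ZMod 4, c + c = 0 → reduceHom c = 0 := by decide

/-- If b j were odd, a second variable x l, available since m ≥ 2, would produce the term 2 x j x l
in the correction, which is not affine. -/
theorem translationKernel_subset (hm : 2 ≤ m) :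
    translationKernel (Set.range fun p => graySum (affineWord m s p)) ⊆
    Set.range fun p => graySum (affineWord m s (evenCoeffs m s p)) := by
  intro v hv
  obtain ⟨⟨a, b, t⟩, rfl⟩ : ∃ p, graySum (affineWord m s p) = v := by
    obtain ⟨p, hp⟩ := hv _ ⟨0, rfl⟩
    have h0 : graySum (affineWord m s 0) = 0 := by
      rw [map_zero]
      funext x
      rcases x with i | i <;> rfl
    refine ⟨p, hp.trans ?_⟩
    simp only [h0, add_zero]
  have hb : ∀ j, reduceHom (b j) = 0 := by
    intro j
    obtain ⟨l, hl⟩ : ∃ l : Fin m, l ≠ j := by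
      have : Nontrivial (Fin m) := Fin.nontrivial_iff_two_le.2 hm
      exact exists_ne j
    let q : Coeffs m s := (0, Pi.single l 1, 0)
    have hq : ∀ x, affineWord m s q x = x.1 l := fun x => by
      simp [affineWord_apply, q, Pi.single_apply]
    obtain ⟨c, hc⟩ := hv _ ⟨q, rfl⟩
    simp only at hc
    rw [graySum_add] at hc
    have hc' := graySum_injective hc
    obtain ⟨r, hr⟩ : ∃ r, affineWord m s r =
        (affineWord m s (a, b, t) + affineWord m s (a, b, t)) * affineWord m s q :=
      ⟨c - (a, b, t) - q, by rw [map_sub, map_sub, hc']; abel⟩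
    have hr' : ∀ x, affineWord m s r (x, 0) =
        (a + ∑ i, b i * x i + (a + ∑ i, b i * x i)) * x l := by
      intro x
      rw [hr, Pi.mul_apply, hq]
      simp [affineWord_apply]
    -- Affine functions have zero second difference; evaluated on the product formula `hr'` this
    -- leaves 2 b j = 0.
    have hadd : affineWord m s r (Pi.single j 1 + Pi.single l 1, 0) + affineWord m s r (0, 0) =
        affineWord m s r (Pi.single j 1, 0) + affineWord m s r (Pi.single l 1, 0) := by
      simp only [affineWord_apply, Pi.add_apply, mul_add, Finset.sum_add_distrib, Pi.zero_apply,
        mul_zero, Finset.sum_const_zero, map_zero]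
      ring
    simp only [hr'] at hadd
    simp [Pi.single_apply, hl, mul_add, Finset.sum_add_distrib] at hadd
    apply reduceHom_eq_zero_of_add_self
    linear_combination hadd
  choose β hβ using fun j => exists_doubleHom_of_reduceHom _ (hb j)
  refine ⟨(a, β, t), ?_⟩
  simp only [evenCoeffs]
  rw [show b = doubleHom ∘ β from funext hβ]

theorem HasAffineType.ncard_translationKernel {J : Type*} {C : Set (J → ZMod 2)}
    (h : HasAffineType C m s) : (translationKernel C).ncard =
      (translationKernel (Set.range fun p => graySum (affineWord m s p))).ncard := by
  obtain ⟨e, rfl⟩ := h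
  rw [← ncard_translationKernel_image e 0, ← Set.range_comp]
  simp only [add_zero]
  rfl

theorem HasAffineType.le_ncard_translationKernel {J : Type*} {C : Set (J → ZMod 2)}
    (h : HasAffineType C m s) : 2 ^ (m + s + 2) ≤ (translationKernel C).ncard := by
  rw [h.ncard_translationKernel, ← ncard_range_evenCoeffs]
  exact Set.ncard_le_ncard range_evenCoeffs_subset (Set.toFinite _)

theorem HasAffineType.ncard_translationKernel_le {J : Type*} {C : Set (J → ZMod 2)}
    (h : HasAffineType C m s) (hm : 2 ≤ m) : (translationKernel C).ncard ≤ 2 ^ (m + s + 2) := by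
  rw [h.ncard_translationKernel, ← ncard_range_evenCoeffs]
  exact Set.ncard_le_ncard (translationKernel_subset hm) (Set.toFinite _)

end Kernel

/-! ### Classification by rank -/

section Classification

variable {N m s m' s' : ℕ} {C C' : BinaryCode N}

theorem HasAffineType.equivalent (h : HasAffineType C m s) (h' : HasAffineType C' m s) :
    C.Equivalent C' := by
  obtain ⟨e, rfl⟩ := h
  obtain ⟨e', rfl⟩ := h'
  refine ⟨0, e.trans e'.symm, ?_⟩
  rw [← Set.range_comp]
  congr 1
  funext p x
  simp

/-- For fixed length 2m + s is fixed, so m + s falls as m grows. If m < m', the lower kernel bound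
for C exceeds the upper one for C', which applies since m' ≥ 2. -/
theorem HasAffineType.rank_le (h : HasAffineType C m s) (h' : HasAffineType C' m' s')
    (hC : C.Equivalent C') (hm : 1 ≤ m) : m' ≤ m := by
  by_contra! hlt
  have h1 := h.le_ncard_translationKernel
  have h2 := h'.ncard_translationKernel_le (by omega)
  obtain ⟨y, π, rfl⟩ := hC
  rw [ncard_translationKernel_image] at h1
  have h3 := (Nat.pow_le_pow_iff_right (by norm_num)).1 (h1.trans h2)
  have h4 : 2 * m + s + 1 = 2 * m' + s' + 1 :=
    Nat.pow_right_injective le_rfl (h.card_eq.symm.trans h'.card_eq)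
  omega

theorem exists_hasAffineType {k : ℕ} (hN : N = 2 ^ k) (hk : k = 2 * m + s + 1) :
    ∃ C : BinaryCode N, HasAffineType C m s := by
  have hcard : Fintype.card (Fin N) = Fintype.card (AffinePoint m s ⊕ AffinePoint m s) := by
    rw [Fintype.card_sum, card_affinePoint, Fintype.card_fin, hN, hk, pow_succ]; ring
  exact ⟨_, Fintype.equivOfCardEq hcard, rfl⟩

end Classification

theorem theorem4 (k N : ℕ) (hN : N = 2 ^ k) (h8 : 8 ≤ N) :
    Nat.card (Quotient (z4LinearHadamardSetoid N)) = (k - 1) / 2 := by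
  have hk : 3 ≤ k := by
    rw [hN] at h8
    exact (Nat.pow_le_pow_iff_right (a := 2) (by norm_num)).1 h8
  -- Representatives have ranks 1, …, ⌊(k−1)/2⌋; rank 0 is omitted because it duplicates rank 1.
  have hex : ∀ j : Fin ((k - 1) / 2), ∃ C : Z4LinearHadamardCode N,
      HasAffineType C.1 (j + 1) (k - 1 - 2 * (j + 1)) := by
    intro j
    obtain ⟨C, hC⟩ := exists_hasAffineType (m := j + 1) (s := k - 1 - 2 * (j + 1)) hN (by omega)
    exact ⟨⟨C, hC.isZ4Linear, hC.isHadamardCode⟩, hC⟩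
  choose D hD using hex
  have hbij : Function.Bijective fun j =>
      (Quotient.mk (z4LinearHadamardSetoid N) (D j)) := by
    constructor
    · intro i j hij
      have hE : (D i).1.Equivalent (D j).1 := Quotient.exact hij
      have h1 := (hD i).rank_le (hD j) hE (by omega)
      have h2 := (hD j).rank_le (hD i) ((BinaryCode.equivalent_equivalence N).symm hE) (by omega)
      exact Fin.ext (by omega)
    · intro c
      induction c using Quotient.ind with | _ C
      obtain ⟨m, s, h⟩ : ∃ m s, HasAffineType C.1 (m + 1) s := by
        obtain ⟨m, s, h⟩ := exists_hasAffineType_of_isHadamardCode (by omega) C.2.1 C.2.2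
        have hkm : k = 2 * m + s + 1 :=
          Nat.pow_right_injective le_rfl (hN.symm.trans h.card_eq)
        cases m with
        | zero =>
          -- Here s = k − 1 ≥ 2, the only place where N ≥ 8 rather than N ≥ 2 is essential.
          obtain ⟨s, rfl⟩ : ∃ s', s = s' + 2 := ⟨s - 2, by omega⟩
          exact ⟨0, s, h.rank_one⟩
        | succ m => exact ⟨m, s, h⟩
      have hkm : k = 2 * (m + 1) + s + 1 :=
        Nat.pow_right_injective le_rfl (hN.symm.trans h.card_eq)
      have hs : s = k - 1 - 2 * (m + 1) := by omega
      subst hs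
      exact ⟨⟨m, by omega⟩, Quotient.sound ((hD ⟨m, by omega⟩).equivalent h)⟩
  rw [← Nat.card_congr (Equiv.ofBijective _ hbij), Nat.card_fin]
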